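/- For each $n \ge 0$, let $U_0, \dots, U_n$ be i.i.d. random variables uniform on $(0,1)$, and let $(a_{n,0}, \dots, a_{n,n})$ be a random vector distributed as $(U_0, \dots, U_n)$ conditioned on the event that $U_{i-1} U_{i+1} \le U_i^2$ for all $1 \le i \le n-1$; equivalently, $(a_{n,0},\dots,a_{n,n})$ is uniformly distributed on the set of log-concave sequences in $[0,1]^{n+1}$. Suppose that these random vectors, for all $n$, are defined on a common probability space, with an arbitrary joint distribution across different $n$. Let $P_n(z) = \sum_{i=0}^n a_{n,i} z^i$ (which almost surely has degree $n$), and let $\zeta_{n,1}, \dots, \zeta_{n,n}$ be its complex roots, counted with multiplicity. Then, almost surely, $$ d_L\Big( \frac1n \sum_{k=1}^n \delta_{\zeta_{n,k}},\ \mathsf{U}(\mathbb{S}^1) \Big) \longrightarrow 0 \qquad (n \to \infty), $$ where $\mathsf{U}(\mathbb{S}^1)$ is the uniform probability measure on the unit circle $\mathbb{S}^1 = \{z \in \mathbb{C} : |z| = 1\}$ and $d_L$ is the Lévy–Prokhorov metric on probability measures on $\mathbb{C}$. -/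

import Mathlib

open MeasureTheory ProbabilityTheory Filter Topology Polynomial
open scoped ENNReal

noncomputable section

/-- The set of vectors `(x_0, …, x_n)` that are log-concave sequences:
`x_{i-1} x_{i+1} ≤ x_i ^ 2` for `1 ≤ i ≤ n - 1` (the index below is `i - 1`). -/
def logConcaveSet (n : ℕ) : Set (Fin (n + 1) → ℝ) :=
  {x | ∀ (i : ℕ) (h : i + 2 < n + 1),
    x ⟨i, by omega⟩ * x ⟨i + 2, h⟩ ≤ x ⟨i + 1, by omega⟩ ^ 2}

/-- The joint law of i.i.d. random variables `U_0, …, U_n`, each uniform on `(0, 1)`. -/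
def iidUniform (n : ℕ) : Measure (Fin (n + 1) → ℝ) :=
  Measure.pi fun _ => (volume : Measure ℝ).restrict (Set.Ioo 0 1)

/-- The law of the coefficient vector `(a_0, …, a_n)` in the uniform model: the law of
`(U_0, …, U_n)` conditioned on the event that this sequence is log-concave. -/
def uniformModel (n : ℕ) : Measure (Fin (n + 1) → ℝ) :=
  (iidUniform n)[|logConcaveSet n]

/-- The polynomial `∑_{i=0}^n a_i z^i`, as a complex polynomial. -/
def coeffPoly {n : ℕ} (a : Fin (n + 1) → ℝ) : ℂ[X] :=
  ∑ i : Fin (n + 1), C (a i : ℂ) * X ^ (i : ℕ)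

/-- The empirical measure `n⁻¹ ∑ δ_ζ`, the sum being over the complex roots `ζ` of
`∑_{i=0}^n a_i z^i`, counted with multiplicity. -/
def empiricalRootMeasure {n : ℕ} (a : Fin (n + 1) → ℝ) : Measure ℂ :=
  (n : ℝ≥0∞)⁻¹ • ((coeffPoly a).roots.map fun ζ => Measure.dirac ζ).sum

/-- The uniform distribution on the unit circle, as a measure on `ℂ`: the law of
`exp (2 π i t)` for `t` uniform on `(0, 1)`. -/
def uniformCircle : Measure ℂ :=
  ((volume : Measure ℝ).restrict (Set.Ioo 0 1)).map
    fun t : ℝ => Complex.exp (2 * Real.pi * t * Complex.I)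

end

/-! Probability enters only once. Coordinatewise squaring maps the log-concave sequences in the open
cube onto themselves with Jacobian `2 ^ (n + 1) * ∏ x i`, so sequences of small geometric mean form
an exponentially small proportion (`iidUniform_logConcave_inter_prod_le`). By Borel–Cantelli, almost
surely the geometric mean eventually exceeds `1 / 16`.

The rest is deterministic. Unimodality turns this bound into lower bounds `exp (-O(√n))` for the
coefficients with index between `√n` and `n - √n` (`pow_lt_apply_of_mem_largeLogConcaveSet`). Since
all coefficients are at most `1`, the logarithm of the Mahler measure of `P (R z)` is known up to
`o(n)`. Its slope in `log R` counts the roots of modulus below `R`, so all but `o(n)` roots lie near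
the circle (`countP_norm_le`, `countP_le_norm`).

For the angles, `log |P|` on the circle is at most `log (n + 1)` and has mean at least `-o(n)`,
hence has `L¹` norm `o(n)`. Its `m`-th Fourier coefficient is a multiple of the `m`-th power sum of
the roots, those outside the disc being inverted in the circle (`logFourier_eq_sum_roots`). So all
nontrivial moments vanish in the limit, and density of trigonometric polynomials gives weak
convergence. -/

/-! ### Geometric mean of a random log-concave sequence. -/

lemma measurableSet_logConcaveSet (n : ℕ) : MeasurableSet (logConcaveSet n) := by
  have : logConcaveSet n = ⋂ (i : ℕ), ⋂ (h : i + 2 < n + 1), {x : Fin (n + 1) → ℝ |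
      x ⟨i, by omega⟩ * x ⟨i + 2, h⟩ ≤ x ⟨i + 1, by omega⟩ ^ 2} := by
    ext x; simp [logConcaveSet]
  rw [this]
  refine MeasurableSet.iInter fun i => MeasurableSet.iInter fun h => ?_
  exact measurableSet_le (by fun_prop) (by fun_prop)

/-- The open unit cube in `ℝ^(n+1)`. -/
def openUnitCube (n : ℕ) : Set (Fin (n + 1) → ℝ) := Set.univ.pi fun _ => Set.Ioo 0 1

lemma measurableSet_openUnitCube (n : ℕ) : MeasurableSet (openUnitCube n) :=
  MeasurableSet.univ_pi fun _ => measurableSet_Ioo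

lemma iidUniform_eq_restrict (n : ℕ) :
    iidUniform n = (volume : Measure (Fin (n + 1) → ℝ)).restrict (openUnitCube n) := by
  rw [iidUniform, openUnitCube, volume_pi, Measure.restrict_pi_pi]

lemma hasFDerivAt_sq_pi {ι : Type*} [Fintype ι] (x : ι → ℝ) :
    HasFDerivAt (fun (y : ι → ℝ) i => y i ^ 2)
      (ContinuousLinearMap.pi fun i =>
        (2 * x i) • ContinuousLinearMap.proj (R := ℝ) (φ := fun _ => ℝ) i) x := by
  rw [hasFDerivAt_pi']
  intro i
  have h : HasFDerivAt (fun y : ι → ℝ => y i)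
      (ContinuousLinearMap.proj (R := ℝ) (φ := fun _ => ℝ) i) x :=
    hasFDerivAt_apply i x
  simpa using h.pow 2

lemma det_pi_smul_proj {ι : Type*} [Fintype ι] [DecidableEq ι] (c : ι → ℝ) :
    (ContinuousLinearMap.pi fun i => c i • ContinuousLinearMap.proj (R := ℝ) (φ := fun _ => ℝ) i :
      (ι → ℝ) →L[ℝ] (ι → ℝ)).det = ∏ i, c i := by
  rw [ContinuousLinearMap.det, ← Matrix.det_diagonal, ← LinearMap.det_toLin']
  congr 1
  ext v i
  simp [Matrix.diagonal_apply, Pi.single_apply, Matrix.mulVec]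

/-- Squaring coordinates preserves log-concavity, and its Jacobian is small where the product of
the coordinates is small. -/
lemma iidUniform_logConcave_inter_prod_le (n : ℕ) :
    iidUniform n (logConcaveSet n ∩ {x | ∏ i, x i ≤ (1 / 16) ^ (n + 1)}) ≤
      (1 / 2) ^ (n + 1) * iidUniform n (logConcaveSet n) := by
  have hcube := measurableSet_openUnitCube n
  rw [iidUniform_eq_restrict, Measure.restrict_apply' hcube, Measure.restrict_apply' hcube]
  set s : Set (Fin (n + 1) → ℝ) :=
    (logConcaveSet n ∩ openUnitCube n) ∩ {x | ∏ i, x i ≤ (1 / 4) ^ (n + 1)} with hs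
  have hsm : MeasurableSet s := by
    refine ((measurableSet_logConcaveSet n).inter hcube).inter ?_
    exact measurableSet_le (by fun_prop) (by fun_prop)
  -- Coordinatewise square roots stay log-concave and in the cube, and turn the threshold `1 / 16`
  -- into `1 / 4`, for which the Jacobian is at most `(2 / 4) ^ (n + 1)`.
  have hsub : logConcaveSet n ∩ {x | ∏ i, x i ≤ (1 / 16) ^ (n + 1)} ∩ openUnitCube n ⊆
      (fun (y : Fin (n + 1) → ℝ) i => y i ^ 2) '' s := by
    rintro x ⟨⟨hx, hp⟩, hc⟩
    have hc' : ∀ i, 0 < x i ∧ x i < 1 := fun i => hc i trivial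
    refine ⟨fun i => √(x i), ⟨⟨?_, ?_⟩, ?_⟩, ?_⟩
    · intro i h
      have := Real.sqrt_le_sqrt (hx i h)
      rw [Real.sqrt_mul (hc' _).1.le, Real.sqrt_sq (hc' _).1.le] at this
      simpa [Real.sq_sqrt (hc' _).1.le] using this
    · intro i _
      exact ⟨Real.sqrt_pos.2 (hc' i).1, (Real.sqrt_lt' one_pos).2 (by simpa using (hc' i).2)⟩
    · simp only [Set.mem_ofPred_eq] at hp ⊢
      refine (sq_le_sq₀ (by positivity) (by positivity)).1 ?_
      rw [← Finset.prod_pow, ← pow_mul, mul_comm (n + 1) 2, pow_mul]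
      norm_num at hp ⊢
      simpa [Real.sq_sqrt (hc' _).1.le] using hp
    · ext i
      simp [Real.sq_sqrt (hc' i).1.le]
  calc volume (logConcaveSet n ∩ {x | ∏ i, x i ≤ (1 / 16) ^ (n + 1)} ∩ openUnitCube n)
      ≤ volume ((fun (y : Fin (n + 1) → ℝ) i => y i ^ 2) '' s) := measure_mono hsub
    _ ≤ ∫⁻ x in s, ENNReal.ofReal |(ContinuousLinearMap.pi fun i => (2 * x i) •
          ContinuousLinearMap.proj (R := ℝ) (φ := fun _ => ℝ) i :
            (Fin (n + 1) → ℝ) →L[ℝ] (Fin (n + 1) → ℝ)).det| :=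
        addHaar_image_le_lintegral_abs_det_fderiv _ hsm
          fun x _ => (hasFDerivAt_sq_pi x).hasFDerivWithinAt
    _ ≤ ∫⁻ _ in s, (1 / 2) ^ (n + 1) := by
        refine setLIntegral_mono measurable_const fun x hx => ?_
        have hc' : ∀ i, 0 < x i := fun i => (hx.1.2 i trivial).1
        have hprod : 0 ≤ ∏ i, x i := Finset.prod_nonneg fun i _ => (hc' i).le
        have h2 : ∏ i, x i ≤ (1 / 4) ^ (n + 1) := hx.2
        rw [det_pi_smul_proj, Finset.prod_mul_distrib, Finset.prod_const, Finset.card_univ,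
          Fintype.card_fin, abs_of_nonneg (by positivity)]
        have : (1 / 2 : ℝ≥0∞) ^ (n + 1) = ENNReal.ofReal ((1 / 2) ^ (n + 1)) := by
          rw [ENNReal.ofReal_pow (by norm_num), ENNReal.ofReal_div_of_pos (by norm_num)]
          simp
        rw [this]
        refine ENNReal.ofReal_le_ofReal ?_
        calc (2 : ℝ) ^ (n + 1) * ∏ i, x i ≤ 2 ^ (n + 1) * (1 / 4) ^ (n + 1) := by gcongr
          _ = (1 / 2) ^ (n + 1) := by rw [← mul_pow]; norm_num
    _ = (1 / 2) ^ (n + 1) * volume s := by simp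
    _ ≤ _ := by gcongr; exact Set.inter_subset_left

/-- The sequences whose geometric mean exceeds `1 / 16`, among the log-concave ones with terms in
`(0, 1)`. -/
def largeLogConcaveSet (n : ℕ) : Set (Fin (n + 1) → ℝ) :=
  openUnitCube n ∩ logConcaveSet n ∩ {x | (1 / 16) ^ (n + 1) < ∏ i, x i}

lemma measurableSet_largeLogConcaveSet (n : ℕ) : MeasurableSet (largeLogConcaveSet n) :=
  ((measurableSet_openUnitCube n).inter (measurableSet_logConcaveSet n)).inter
    (measurableSet_lt (by fun_prop) (by fun_prop))

lemma uniformModel_compl_largeLogConcaveSet_le (n : ℕ) :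
    uniformModel n (largeLogConcaveSet n)ᶜ ≤ (1 / 2) ^ (n + 1) := by
  have hcube : iidUniform n (openUnitCube n)ᶜ = 0 := by
    rw [iidUniform_eq_restrict, Measure.restrict_apply' (measurableSet_openUnitCube n)]
    simp
  rw [uniformModel, cond_apply (measurableSet_logConcaveSet n)]
  have hsub : logConcaveSet n ∩ (largeLogConcaveSet n)ᶜ ⊆
      (openUnitCube n)ᶜ ∪ (logConcaveSet n ∩ {x | ∏ i, x i ≤ (1 / 16) ^ (n + 1)}) := by
    rintro x ⟨hx, hx'⟩
    by_cases hc : x ∈ openUnitCube n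
    · refine Or.inr ⟨hx, ?_⟩
      rw [Set.mem_ofPred_eq, ← not_lt]
      exact fun h => hx' ⟨⟨hc, hx⟩, h⟩
    · exact Or.inl hc
  calc _ ≤ (iidUniform n (logConcaveSet n))⁻¹ *
          ((1 / 2) ^ (n + 1) * iidUniform n (logConcaveSet n)) := by
        gcongr
        refine (measure_mono hsub).trans ((measure_union_le _ _).trans ?_)
        rw [hcube, zero_add]
        exact iidUniform_logConcave_inter_prod_le n
    _ = (1 / 2) ^ (n + 1) *
          ((iidUniform n (logConcaveSet n))⁻¹ * iidUniform n (logConcaveSet n)) := by ring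
    -- Only `≤ 1` is used, so positivity of the probability of log-concavity is not needed here.
    _ ≤ (1 / 2) ^ (n + 1) * 1 := by gcongr; exact ENNReal.inv_mul_le_one _
    _ = _ := mul_one _

/-- The exceptional probabilities are summable, and the first Borel–Cantelli lemma requires no
independence. Only the marginal laws matter, whence the arbitrary coupling across `n`. -/
lemma ae_eventually_mem_largeLogConcaveSet {Ω : Type*} [MeasurableSpace Ω] (P : Measure Ω)
    (a : (n : ℕ) → Ω → Fin (n + 1) → ℝ) (ha : ∀ n : ℕ, HasLaw (a n) (uniformModel n) P) :
    ∀ᵐ ω ∂P, ∀ᶠ n in atTop, a n ω ∈ largeLogConcaveSet n := by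
  have key : ∀ n, P {ω | a n ω ∉ largeLogConcaveSet n} ≤ (1 / 2) ^ (n + 1) := fun n => by
    have h := uniformModel_compl_largeLogConcaveSet_le n
    rw [← (ha n).map_eq, Measure.map_apply_of_aemeasurable (ha n).aemeasurable
      (measurableSet_largeLogConcaveSet n).compl] at h
    exact h
  have hsum : ∑' n, P {ω | a n ω ∉ largeLogConcaveSet n} ≠ ∞ := by
    refine ne_top_of_le_ne_top ?_ (ENNReal.tsum_le_tsum key)
    have : ∀ n : ℕ, (1 / 2 : ℝ≥0∞) ^ (n + 1) = 2⁻¹ ^ n * 2⁻¹ := fun n => by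
      rw [pow_succ]; simp
    simp_rw [this, ENNReal.tsum_mul_right, ENNReal.tsum_geometric]
    simp
  filter_upwards [ae_eventually_notMem hsum] with ω hω
  filter_upwards [hω] with n hn
  simpa using hn

/-! ### Unimodality and lower bounds for single coefficients. -/

/-- A positive log-concave sequence on `{0, …, n}` is unimodal: each term dominates all earlier
terms or all later ones. -/
lemma logConcave_forall_le_or_forall_ge {n : ℕ} {y : ℕ → ℝ} (hpos : ∀ j ≤ n, 0 < y j)
    (hlc : ∀ j, j + 2 ≤ n → y j * y (j + 2) ≤ y (j + 1) ^ 2) {i : ℕ} (hi : i ≤ n) :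
    (∀ j ≤ i, y j ≤ y i) ∨ ∀ j, i ≤ j → j ≤ n → y j ≤ y i := by
  by_cases hin : i = n
  · right
    intro j h1 h2
    rw [show j = i by omega]
  -- Consecutive ratios are nonincreasing, so a descent at `i` propagates to the right and an ascent
  -- propagates to the left.
  rcases le_or_gt (y (i + 1)) (y i) with h | h
  · right
    have step : ∀ d, i + d + 1 ≤ n → y (i + d + 1) ≤ y (i + d) := by
      intro d
      induction d with
      | zero => exact fun _ => h
      | succ d ih =>
        intro hd
        have h1 := ih (by omega)
        have h2 := hlc (i + d) (by omega)
        have h3 := hpos (i + d) (by omega)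
        have h4 := hpos (i + d + 1) (by omega)
        rw [show i + (d + 1) + 1 = i + d + 2 by omega, show i + (d + 1) = i + d + 1 by omega]
        refine le_of_mul_le_mul_left (h2.trans ?_) h3
        rw [sq]
        exact mul_le_mul_of_nonneg_right h1 h4.le
    intro j hij
    induction j, hij using Nat.le_induction with
    | base => exact fun _ => le_rfl
    | succ j hij ih =>
      intro hj
      obtain ⟨d, rfl⟩ := Nat.exists_eq_add_of_le hij
      exact (step d hj).trans (ih (by omega))
  · left
    have step : ∀ d ≤ i, y (i - d) ≤ y (i - d + 1) := by
      intro d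
      induction d with
      | zero => exact fun _ => h.le
      | succ d ih =>
        intro hd
        have h1 := ih (by omega)
        have h2 := hlc (i - (d + 1)) (by omega)
        have h3 := hpos (i - d) (by omega)
        have h4 := hpos (i - d + 1) (by omega)
        rw [show i - (d + 1) + 2 = i - d + 1 by omega,
          show i - (d + 1) + 1 = i - d by omega] at h2
        rw [show i - (d + 1) + 1 = i - d by omega]
        refine le_of_mul_le_mul_right (h2.trans ?_) h4
        rw [sq]
        exact mul_le_mul_of_nonneg_left h1 h3.le
    have : ∀ d ≤ i, y (i - d) ≤ y i := by
      intro d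
      induction d with
      | zero => exact fun _ => le_rfl
      | succ d ih =>
        intro hd
        refine (step (d + 1) hd).trans ?_
        rw [show i - (d + 1) + 1 = i - d by omega]
        exact ih (by omega)
    intro j hj
    have := this (i - j) (by omega)
    rwa [show i - (i - j) = j by omega] at this

/-- By unimodality `y i` dominates one of the blocks `{0, …, i}`, `{i, …, n}`, each of which has at
least `m` elements; the factors outside that block are at most `1`. -/
lemma prod_range_le_pow_of_logConcave {n : ℕ} {y : ℕ → ℝ} (hpos : ∀ j ≤ n, 0 < y j)
    (hone : ∀ j ≤ n, y j ≤ 1) (hlc : ∀ j, j + 2 ≤ n → y j * y (j + 2) ≤ y (j + 1) ^ 2)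
    {i m : ℕ} (hm : m ≤ i + 1) (him : i + m ≤ n + 1) (hi : i ≤ n) :
    ∏ j ∈ Finset.range (n + 1), y j ≤ y i ^ m := by
  have key : ∀ S ⊆ Finset.range (n + 1), m ≤ S.card → (∀ j ∈ S, y j ≤ y i) →
      ∏ j ∈ Finset.range (n + 1), y j ≤ y i ^ m := by
    intro S hS hcard hle
    have hmem : ∀ j ∈ S, j ≤ n := fun j hj => by
      have := Finset.mem_range.1 (hS hj); omega
    calc ∏ j ∈ Finset.range (n + 1), y j ≤ ∏ j ∈ S, y j := by
          rw [← Finset.prod_sdiff hS]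
          refine mul_le_of_le_one_left (Finset.prod_nonneg fun j hj => (hpos j (hmem j hj)).le) ?_
          refine Finset.prod_le_one (fun j hj => ?_) (fun j hj => ?_)
          all_goals
            have := Finset.mem_range.1 (Finset.mem_sdiff.1 hj).1
          · exact (hpos j (by omega)).le
          · exact hone j (by omega)
      _ ≤ ∏ j ∈ S, y i := Finset.prod_le_prod (fun j hj => (hpos j (hmem j hj)).le) hle
      _ = y i ^ S.card := by simp
      _ ≤ y i ^ m := pow_le_pow_of_le_one (hpos i hi).le (hone i hi) hcard
  rcases logConcave_forall_le_or_forall_ge hpos hlc hi with h | h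
  · refine key (Finset.range (i + 1)) (Finset.range_mono (by omega)) (by simpa using hm) ?_
    intro j hj
    exact h j (by have := Finset.mem_range.1 hj; omega)
  · refine key (Finset.Ico i (n + 1)) ?_ (by simp; omega) ?_
    · intro j hj
      exact Finset.mem_range.2 (Finset.mem_Ico.1 hj).2
    · intro j hj
      have := Finset.mem_Ico.1 hj
      exact h j this.1 (by omega)

lemma pow_lt_apply_of_mem_largeLogConcaveSet {n k i : ℕ} {x : Fin (n + 1) → ℝ}
    (hx : x ∈ largeLogConcaveSet n) (hn : n + 1 ≤ (k + 1) ^ 2) (hki : k ≤ i) (hikn : i + k ≤ n) :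
    (1 / 16) ^ (k + 1) < x ⟨i, by omega⟩ := by
  obtain ⟨⟨hc, hlc⟩, hp⟩ := hx
  have hc' : ∀ i, 0 < x i ∧ x i < 1 := fun i => hc i trivial
  set y : ℕ → ℝ := fun j => if h : j < n + 1 then x ⟨j, h⟩ else 0 with hy
  have hyx : ∀ j (h : j ≤ n), y j = x ⟨j, by omega⟩ := fun j h => by
    simp only [hy]
    exact dif_pos (by omega)
  have hprod : ∏ j ∈ Finset.range (n + 1), y j = ∏ j, x j := by
    rw [Finset.prod_range]
    exact Finset.prod_congr rfl fun j _ => hyx j (by omega)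
  have h1 : ∏ j ∈ Finset.range (n + 1), y j ≤ y i ^ (k + 1) := by
    refine prod_range_le_pow_of_logConcave (n := n) (fun j hj => ?_) (fun j hj => ?_)
      (fun j hj => ?_) (by omega) (by omega) (by omega)
    · rw [hyx j hj]; exact (hc' _).1
    · rw [hyx j hj]; exact (hc' _).2.le
    · rw [hyx j (by omega), hyx (j + 1) (by omega), hyx (j + 2) hj]
      exact hlc j (by omega)
  rw [hprod, hyx i (by omega)] at h1
  have h2 : (1 / 16 : ℝ) ^ (n + 1) < ∏ j, x j := hp
  -- Here `k` of order `√n` suffices: the block length `k + 1` also serves as the exponent in the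
  -- lower bound.
  have h3 : ((1 / 16 : ℝ) ^ (k + 1)) ^ (k + 1) ≤ (1 / 16) ^ (n + 1) := by
    rw [← pow_mul, ← sq]
    exact pow_le_pow_of_le_one (by norm_num) (by norm_num) hn
  exact lt_of_pow_lt_pow_left₀ (k + 1) (hc' _).1.le ((h3.trans_lt h2).trans_le h1)

/-! ### Mahler measures on circles and the moduli of the roots. -/

/-- The Mahler measure is multiplicative, and each linear factor `R X - z` contributes `max R ‖z‖`.
-/
lemma mahlerMeasure_comp_C_mul_X (P : ℂ[X]) {R : ℝ} (hR : 0 < R) :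
    (P.comp (C (R : ℂ) * X)).mahlerMeasure =
      ‖P.leadingCoeff‖ * (P.roots.map fun z => max R ‖z‖).prod := by
  conv_lhs => rw [(IsAlgClosed.splits P).eq_prod_roots]
  rw [mul_comp, C_comp, mahlerMeasure_mul, mahlerMeasure_const, multiset_prod_comp,
    prod_mahlerMeasure_eq_mahlerMeasure_prod, Multiset.map_map, Multiset.map_map]
  congr 3
  ext z
  have hR' : (R : ℂ) ≠ 0 := by exact_mod_cast hR.ne'
  have := mahlerMeasure_C_mul_X_add_C hR' (-z)
  simpa [sub_eq_add_neg, abs_of_pos hR] using this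

lemma natDegree_comp_C_mul_X (P : ℂ[X]) {c : ℂ} (hc : c ≠ 0) :
    (P.comp (C c * X)).natDegree = P.natDegree := by
  rw [natDegree_comp, natDegree_C_mul_X c hc, mul_one]

lemma norm_coeff_mul_pow_le (P : ℂ[X]) {R : ℝ} (hR : 0 < R) (j : ℕ) :
    ‖P.coeff j‖ * R ^ j ≤ P.natDegree.choose j *
      (‖P.leadingCoeff‖ * (P.roots.map fun z => max R ‖z‖).prod) := by
  have h := norm_coeff_le_choose_mul_mahlerMeasure j (P.comp (C (R : ℂ) * X))
  rw [natDegree_comp_C_mul_X P (by exact_mod_cast hR.ne'), mahlerMeasure_comp_C_mul_X P hR,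
    comp_C_mul_X_coeff] at h
  simpa [abs_of_pos hR] using h

lemma leadingCoeff_mul_prod_max_le (P : ℂ[X]) (hP : ∀ i, ‖P.coeff i‖ ≤ 1) {R : ℝ} (hR : 0 < R) :
    ‖P.leadingCoeff‖ * (P.roots.map fun z => max R ‖z‖).prod ≤
      (P.natDegree + 1) * max 1 R ^ P.natDegree := by
  rw [← mahlerMeasure_comp_C_mul_X P hR]
  refine (mahlerMeasure_le_sum_norm_coeff _).trans ?_
  rw [sum_over_range _ (by simp), natDegree_comp_C_mul_X P (by exact_mod_cast hR.ne')]
  calc _ ≤ ∑ i ∈ Finset.range (P.natDegree + 1), max 1 R ^ P.natDegree := by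
        refine Finset.sum_le_sum fun i hi => ?_
        have hi' : i ≤ P.natDegree := by have := Finset.mem_range.1 hi; omega
        rw [comp_C_mul_X_coeff, norm_mul, norm_pow, Complex.norm_real, Real.norm_of_nonneg hR.le]
        calc ‖P.coeff i‖ * R ^ i ≤ 1 * max 1 R ^ i := by
              gcongr
              · exact hP i
              · exact le_max_right _ _
          _ ≤ max 1 R ^ P.natDegree := by
              rw [one_mul]; exact pow_le_pow_right₀ (le_max_left _ _) hi'
    _ = _ := by simp

lemma log_prod_max_norm (s : Multiset ℂ) {R : ℝ} (hR : 0 < R) :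
    Real.log (s.map fun z => max R ‖z‖).prod = (s.map fun z => Real.log (max R ‖z‖)).sum := by
  induction s using Multiset.induction_on with
  | empty => simp
  | cons z s ih =>
    have : (s.map fun z => max R ‖z‖).prod ≠ 0 :=
      (Multiset.prod_pos fun x hx => by
        obtain ⟨z, _, rfl⟩ := Multiset.mem_map.1 hx
        exact lt_max_of_lt_left hR).ne'
    rw [Multiset.map_cons, Multiset.prod_cons, Multiset.map_cons, Multiset.sum_cons,
      Real.log_mul (lt_max_of_lt_left hR).ne' this, ih]

open Classical in
-- Points of modulus at most `R` each contribute exactly `log R' - log R` to the right side; the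
-- others contribute a nonnegative amount.
lemma countP_le_sum_log_max_sub (s : Multiset ℂ) {R R' : ℝ} (hR : 0 < R) (hRR' : R ≤ R') :
    (Real.log R' - Real.log R) * (s.countP fun z => ‖z‖ ≤ R) ≤
      (s.map fun z => Real.log (max R' ‖z‖)).sum - (s.map fun z => Real.log (max R ‖z‖)).sum := by
  induction s using Multiset.induction_on with
  | empty => simp
  | cons z s ih =>
    rw [Multiset.countP_cons, Multiset.map_cons, Multiset.sum_cons, Multiset.map_cons,
      Multiset.sum_cons]
    split_ifs with h
    · rw [max_eq_left h, max_eq_left (h.trans hRR')]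
      push_cast
      linarith
    · have : Real.log (max R ‖z‖) ≤ Real.log (max R' ‖z‖) :=
        Real.log_le_log (lt_max_of_lt_left hR) (max_le_max_right _ hRR')
      push_cast
      linarith

open Classical in
-- No point contributes more than `log R' - log R` to the difference of sums, and points of modulus
-- at least `R'` contribute nothing.
lemma countP_le_card_sub_sum_log_max (s : Multiset ℂ) {R R' : ℝ} (hR : 0 < R) (hRR' : R ≤ R') :
    (Real.log R' - Real.log R) * (s.countP fun z => R' ≤ ‖z‖) ≤
      (Real.log R' - Real.log R) * s.card - ((s.map fun z => Real.log (max R' ‖z‖)).sum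
        - (s.map fun z => Real.log (max R ‖z‖)).sum) := by
  induction s using Multiset.induction_on with
  | empty => simp
  | cons z s ih =>
    rw [Multiset.countP_cons, Multiset.map_cons, Multiset.sum_cons, Multiset.map_cons,
      Multiset.sum_cons, Multiset.card_cons]
    split_ifs with h
    · rw [max_eq_right h, max_eq_right (hRR'.trans h)]
      push_cast
      linarith
    · have : Real.log (max R' ‖z‖) - Real.log (max R ‖z‖) ≤ Real.log R' - Real.log R := by
        rw [max_eq_left (not_le.1 h).le]
        have := Real.log_le_log hR (le_max_left R ‖z‖)
        linarith
      push_cast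
      linarith

/-- A polynomial of degree `n` with coefficients bounded by `1` such that those of index `k` and
`n - k` are not too small, as measured by `L`. -/
structure BalancedPoly (P : ℂ[X]) (n k : ℕ) (L : ℝ) : Prop where
  natDegree_eq : P.natDegree = n
  leadingCoeff_ne : P.leadingCoeff ≠ 0
  le : k ≤ n
  norm_coeff_le : ∀ i, ‖P.coeff i‖ ≤ 1
  -- The binomial coefficient offsets the one lost when a coefficient is bounded by the Mahler
  -- measure.
  low : Real.exp (-L) * n.choose k ≤ ‖P.coeff k‖
  high : Real.exp (-L) * n.choose k ≤ ‖P.coeff (n - k)‖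

namespace BalancedPoly

variable {P : ℂ[X]} {n k : ℕ} {L : ℝ}

/-- The logarithm of the Mahler measure of `P (R z)`. -/
noncomputable def radialLog (P : ℂ[X]) (R : ℝ) : ℝ :=
  Real.log ‖P.leadingCoeff‖ + (P.roots.map fun z => Real.log (max R ‖z‖)).sum

lemma radialLog_eq (h : BalancedPoly P n k L) {R : ℝ} (hR : 0 < R) :
    Real.log (‖P.leadingCoeff‖ * (P.roots.map fun z => max R ‖z‖).prod) = radialLog P R := by
  have : (P.roots.map fun z => max R ‖z‖).prod ≠ 0 :=
      (Multiset.prod_pos fun x hx => by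
        obtain ⟨z, _, rfl⟩ := Multiset.mem_map.1 hx
        exact lt_max_of_lt_left hR).ne'
  rw [Real.log_mul (norm_ne_zero_iff.2 h.leadingCoeff_ne) this, log_prod_max_norm _ hR, radialLog]

lemma pos (h : BalancedPoly P n k L) {R : ℝ} (hR : 0 < R) :
    0 < ‖P.leadingCoeff‖ * (P.roots.map fun z => max R ‖z‖).prod :=
  mul_pos (norm_pos_iff.2 h.leadingCoeff_ne) <| Multiset.prod_pos fun x hx => by
    obtain ⟨z, _, rfl⟩ := Multiset.mem_map.1 hx
    exact lt_max_of_lt_left hR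

lemma radialLog_le (h : BalancedPoly P n k L) {R : ℝ} (hR : 0 < R) :
    radialLog P R ≤ Real.log (n + 1) + n * Real.log (max 1 R) := by
  have h1 := Real.log_le_log (h.pos hR) (leadingCoeff_mul_prod_max_le P h.norm_coeff_le hR)
  have hm : 0 < max 1 R := lt_max_of_lt_right hR
  rwa [h.radialLog_eq hR, h.natDegree_eq, Real.log_mul (by positivity) (by positivity),
    Real.log_pow] at h1

lemma le_radialLog_of_le_norm_coeff (h : BalancedPoly P n k L) {R : ℝ} (hR : 0 < R) {j : ℕ}
    (hj : n.choose j = n.choose k) (hc : Real.exp (-L) * n.choose k ≤ ‖P.coeff j‖) :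
    j * Real.log R - L ≤ radialLog P R := by
  have hch : (0 : ℝ) < n.choose k := by exact_mod_cast Nat.choose_pos h.le
  have h1 := norm_coeff_mul_pow_le P hR j
  rw [h.natDegree_eq, hj] at h1
  have h2 : Real.exp (-L) * R ^ j ≤
      ‖P.leadingCoeff‖ * (P.roots.map fun z => max R ‖z‖).prod := by
    refine le_of_mul_le_mul_left ?_ hch
    calc n.choose k * (Real.exp (-L) * R ^ j) = Real.exp (-L) * n.choose k * R ^ j := by ring
      _ ≤ ‖P.coeff j‖ * R ^ j := by gcongr
      _ ≤ _ := h1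
  have h3 := Real.log_le_log (by positivity) h2
  rw [h.radialLog_eq hR, Real.log_mul (by positivity) (by positivity), Real.log_exp,
    Real.log_pow] at h3
  linarith

lemma low_le_radialLog (h : BalancedPoly P n k L) {R : ℝ} (hR : 0 < R) :
    k * Real.log R - L ≤ radialLog P R :=
  h.le_radialLog_of_le_norm_coeff hR rfl h.low

lemma high_le_radialLog (h : BalancedPoly P n k L) {R : ℝ} (hR : 0 < R) :
    (n - k) * Real.log R - L ≤ radialLog P R := by
  have := h.le_radialLog_of_le_norm_coeff hR (Nat.choose_symm h.le) h.high
  rwa [Nat.cast_sub h.le] at this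

lemma card_roots (h : BalancedPoly P n k L) : P.roots.card = n := by
  rw [← h.natDegree_eq]
  exact ((IsAlgClosed.splits P).natDegree_eq_card_roots).symm

open Classical in
-- Between radii `exp (-s)` and `1`, `radialLog` grows little: the `k`-th coefficient bounds it
-- below at the former, the size of the coefficients bounds it above at the latter.
lemma countP_norm_le (h : BalancedPoly P n k L) {s : ℝ} (hs : 0 < s) :
    s * (P.roots.countP fun z => ‖z‖ ≤ Real.exp (-s)) ≤ Real.log (n + 1) + L + k * s := by
  have h1 := countP_le_sum_log_max_sub P.roots (Real.exp_pos (-s))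
    (show Real.exp (-s) ≤ 1 from Real.exp_le_one_iff.2 (by linarith))
  have h2 := h.radialLog_le one_pos
  have h3 := h.low_le_radialLog (Real.exp_pos (-s))
  simp only [radialLog, Real.log_exp, Real.log_one, max_self] at h1 h2 h3
  linarith

open Classical in
-- Between radii `exp s` and `exp (2 * s)`, the coefficient of index `n - k` forces `radialLog` to
-- grow by almost the maximal amount `n * s`, leaving few roots beyond.
lemma countP_le_norm (h : BalancedPoly P n k L) {s : ℝ} (hs : 0 < s) :
    s * (P.roots.countP fun z => Real.exp (2 * s) ≤ ‖z‖) ≤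
      Real.log (n + 1) + L + 2 * k * s := by
  have h1 := countP_le_card_sub_sum_log_max P.roots (Real.exp_pos s)
    (show Real.exp s ≤ Real.exp (2 * s) from Real.exp_le_exp.2 (by linarith))
  have h2 := h.radialLog_le (Real.exp_pos s)
  have h3 := h.high_le_radialLog (Real.exp_pos (2 * s))
  rw [max_eq_right (Real.one_le_exp hs.le)] at h2
  simp only [radialLog, Real.log_exp, h.card_roots] at h1 h2 h3
  linarith

lemma logMahlerMeasure_ge (h : BalancedPoly P n k L) : -L ≤ P.logMahlerMeasure := by
  have := h.low_le_radialLog one_pos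
  rw [logMahlerMeasure_eq_log_MahlerMeasure, mahlerMeasure_eq_leadingCoeff_mul_prod_roots,
    h.radialLog_eq one_pos]
  simpa using this

end BalancedPoly

/-! ### Fourier coefficients of `log |P|` on the unit circle. -/

lemma integral_exp_int_mul_I (m : ℤ) :
    ∫ θ : ℝ in (0)..(2 * Real.pi), Complex.exp (m * θ * Complex.I) =
      if m = 0 then 2 * (Real.pi : ℂ) else 0 := by
  split_ifs with h
  · simp [h]
  · have hc : (m * Complex.I : ℂ) ≠ 0 := by simp [h]
    have h1 := integral_exp_mul_complex (a := 0) (b := 2 * Real.pi) hc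
    have h2 : ∀ θ : ℝ, (m * θ * Complex.I : ℂ) = m * Complex.I * θ := fun θ => by ring
    simp_rw [h2, h1]
    have h3 : (m * Complex.I * ((2 * Real.pi : ℝ) : ℂ) : ℂ) = m * (2 * Real.pi * Complex.I) := by
      push_cast; ring
    rw [h3, Complex.exp_int_mul_two_pi_mul_I]
    simp

lemma ofReal_log_norm_eq (z : ℂ) :
    ((Real.log ‖z‖ : ℝ) : ℂ) =
      (Complex.log z + (starRingEnd ℂ) (Complex.log z)) / 2 := by
  rw [Complex.add_conj, Complex.log_re]
  push_cast
  ring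

lemma circleMap_zero_one (θ : ℝ) : circleMap 0 1 θ = Complex.exp (θ * Complex.I) := by
  simp [circleMap]

/-- Expand `log |1 - w|` as the real part of the Taylor series of `log (1 - w)` and integrate
termwise; by orthogonality only the conjugate term of index `k` survives. -/
lemma integral_log_norm_one_sub_mul_pow_of_lt {b : ℂ} (hb : ‖b‖ < 1) {k : ℕ} (hk : k ≠ 0) :
    ∫ θ : ℝ in (0)..(2 * Real.pi),
      ((Real.log ‖1 - b * circleMap 0 1 θ‖ : ℝ) : ℂ) * circleMap 0 1 θ ^ k =
        -(Real.pi / k) * (starRingEnd ℂ) b ^ k := by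
  -- The term `j = 0` vanishes, since division by zero yields zero.
  set F : ℕ → ℝ → ℂ := fun j θ => -(1 / (2 * j)) *
    (b ^ j * Complex.exp ((j + k : ℤ) * θ * Complex.I) +
      (starRingEnd ℂ) b ^ j * Complex.exp ((k - j : ℤ) * θ * Complex.I)) with hF
  have hFsum : ∀ θ : ℝ, HasSum (fun j => F j θ)
      (((Real.log ‖1 - b * circleMap 0 1 θ‖ : ℝ) : ℂ) * circleMap 0 1 θ ^ k) := by
    intro θ
    have hz : ‖b * circleMap 0 1 θ‖ < 1 := by simpa using hb
    have h1 := Complex.hasSum_taylorSeries_neg_log hz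
    have h2 := (Complex.hasSum_conj'.2 h1)
    have h3 := ((h1.add h2).mul_left (-(1 / 2))).mul_right (circleMap 0 1 θ ^ k)
    rw [ofReal_log_norm_eq]
    have e : ∀ j, F j θ = -(1 / 2) * ((b * circleMap 0 1 θ) ^ j / j +
        (starRingEnd ℂ) ((b * circleMap 0 1 θ) ^ j / j)) * circleMap 0 1 θ ^ k := by
      intro j
      simp only [hF, circleMap_zero_one, map_div₀, map_pow, map_mul, Complex.conj_natCast,
        ← Complex.exp_conj, Complex.conj_ofReal, Complex.conj_I, mul_pow, ← Complex.exp_nat_mul]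
      have e1 : Complex.exp ((j + k : ℤ) * θ * Complex.I) =
          Complex.exp (j * (θ * Complex.I)) * Complex.exp (k * (θ * Complex.I)) := by
        rw [← Complex.exp_add]; congr 1; push_cast; ring
      have e2 : Complex.exp ((k - j : ℤ) * θ * Complex.I) =
          Complex.exp (j * (θ * -Complex.I)) * Complex.exp (k * (θ * Complex.I)) := by
        rw [← Complex.exp_add]; congr 1; push_cast; ring
      rw [e1, e2]
      ring
    rw [funext e]
    rw [map_neg] at h3
    rw [show ∀ x y w : ℂ, (x + y) / 2 * w = -(1 / 2) * (-x + -y) * w from fun x y w => by ring]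
    exact h3
  have hint : ∀ j, ∫ θ : ℝ in (0)..(2 * Real.pi), F j θ =
      if j = k then -(Real.pi / k) * (starRingEnd ℂ) b ^ k else 0 := by
    intro j
    simp only [hF]
    rw [intervalIntegral.integral_const_mul, intervalIntegral.integral_add
      (Continuous.intervalIntegrable (by fun_prop) _ _)
      (Continuous.intervalIntegrable (by fun_prop) _ _),
      intervalIntegral.integral_const_mul, intervalIntegral.integral_const_mul,
      integral_exp_int_mul_I, integral_exp_int_mul_I, if_neg (by omega)]
    by_cases hjk : j = k
    · subst hjk
      have : (j : ℂ) ≠ 0 := by exact_mod_cast hk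
      simp
      field_simp
    · rw [if_neg (by omega), if_neg hjk]
      simp
  have hsum := intervalIntegral.hasSum_integral_of_dominated_convergence
    (μ := volume) (a := 0) (b := 2 * Real.pi) (F := F)
    (f := fun θ => ((Real.log ‖1 - b * circleMap 0 1 θ‖ : ℝ) : ℂ) * circleMap 0 1 θ ^ k)
    (fun j _ => ‖b‖ ^ j) (fun j => Continuous.aestronglyMeasurable (by fun_prop))
    (fun j => Eventually.of_forall fun θ _ => ?_)
    (Eventually.of_forall fun θ _ => summable_geometric_of_lt_one (norm_nonneg b) hb)
    intervalIntegrable_const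
    (Eventually.of_forall fun θ _ => hFsum θ)
  · simp_rw [hint] at hsum
    exact hsum.unique (hasSum_ite_eq k _)
  · simp only [hF]
    have he : ∀ m : ℤ, ‖Complex.exp (m * θ * Complex.I)‖ = 1 := fun m => by
      have : (m * θ * Complex.I : ℂ) = ((m * θ : ℝ) : ℂ) * Complex.I := by push_cast; ring
      rw [this, Complex.norm_exp_ofReal_mul_I]
    rw [norm_mul]
    calc _ ≤ (1 / 2 : ℝ) * (‖b‖ ^ j + ‖b‖ ^ j) := by
          gcongr
          · rcases Nat.eq_zero_or_pos j with rfl | hj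
            · simp
            · rw [norm_neg, norm_div, norm_mul]
              simp only [norm_one, Complex.norm_ofNat, Complex.norm_natCast]
              have : (1 : ℝ) ≤ j := by exact_mod_cast hj
              exact one_div_le_one_div_of_le (by norm_num) (by linarith)
          · refine (norm_add_le _ _).trans ?_
            rw [norm_mul, norm_mul, he, he, norm_pow, norm_pow, RCLike.norm_conj, mul_one]
      _ = ‖b‖ ^ j := by ring

lemma ae_eval_circleMap_ne_zero {p : ℂ[X]} (hp : p ≠ 0) :
    ∀ᵐ θ : ℝ, θ ∈ Set.uIoc 0 (2 * Real.pi) → p.eval (circleMap 0 1 θ) ≠ 0 := by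
  rw [MeasureTheory.ae_iff]
  apply Set.Finite.measure_zero _ MeasureTheory.volume
  simp only [Classical.not_imp]
  apply Set.Finite.of_finite_image (f := circleMap 0 1) _ <|
    (injOn_circleMap_of_abs_sub_le one_ne_zero (by simp [le_of_eq, Real.pi_nonneg])).mono
      (fun _ h ↦ h.1)
  apply p.roots.finite_toSet.subset
  rintro _ ⟨_, ⟨_, h⟩, _⟩
  contrapose h
  simp_all

/-- The boundary case, with its logarithmic singularity, follows by replacing `b` with `r * b` and
letting `r` increase to `1` under dominated convergence. -/
lemma integral_log_norm_one_sub_mul_pow {b : ℂ} (hb : ‖b‖ ≤ 1) {k : ℕ} (hk : k ≠ 0) :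
    ∫ θ : ℝ in (0)..(2 * Real.pi),
      ((Real.log ‖1 - b * circleMap 0 1 θ‖ : ℝ) : ℂ) * circleMap 0 1 θ ^ k =
        -(Real.pi / k) * (starRingEnd ℂ) b ^ k := by
  set p : ℂ[X] := 1 - C b * X with hp
  have hp0 : p ≠ 0 := fun h => by
    have := congrArg (fun q : ℂ[X] => q.eval 0) h
    simp [hp] at this
  have hpe : ∀ w, p.eval w = 1 - b * w := fun w => by simp [hp]
  have hint := (intervalIntegrable_mahlerMeasure p).abs
  simp_rw [hpe] at hint
  have hlim : Tendsto (fun r : ℝ => ∫ θ : ℝ in (0)..(2 * Real.pi),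
      ((Real.log ‖1 - r * b * circleMap 0 1 θ‖ : ℝ) : ℂ) * circleMap 0 1 θ ^ k) (𝓝[<] 1)
      (𝓝 (∫ θ : ℝ in (0)..(2 * Real.pi),
        ((Real.log ‖1 - b * circleMap 0 1 θ‖ : ℝ) : ℂ) * circleMap 0 1 θ ^ k)) := by
    refine intervalIntegral.tendsto_integral_filter_of_dominated_convergence
      (fun θ => Real.log 2 + |Real.log ‖1 - b * circleMap 0 1 θ‖|)
      (Eventually.of_forall fun r => ?_) ?_ (intervalIntegrable_const.add hint) ?_
    · refine Measurable.aestronglyMeasurable ?_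
      have : Measurable (circleMap 0 1) := (continuous_circleMap 0 1).measurable
      fun_prop
    · filter_upwards [Ioo_mem_nhdsLT (show (0 : ℝ) < 1 by norm_num)] with r hr
      filter_upwards [ae_eval_circleMap_ne_zero hp0] with θ hθ hmem
      have hne := hθ hmem
      rw [hpe] at hne
      set z := b * circleMap 0 1 θ with hz
      have hz1 : ‖z‖ ≤ 1 := by simpa [hz] using hb
      have hpos : 0 < ‖1 - z‖ := norm_pos_iff.2 hne
      rw [norm_mul, norm_pow, norm_circleMap_zero, abs_one, one_pow, mul_one, Complex.norm_real,
        mul_assoc, ← hz, Real.norm_eq_abs]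
      have hrz : ‖(r : ℂ) * z‖ ≤ r := by
        rw [norm_mul, Complex.norm_real, Real.norm_of_nonneg hr.1.le]
        exact mul_le_of_le_one_right hr.1.le hz1
      have h1 : ‖1 - r * z‖ ≤ 2 := by
        refine (norm_sub_le _ _).trans ?_
        rw [norm_one]; linarith [hr.2]
      have h2 : 1 - r ≤ ‖1 - r * z‖ := by
        have := norm_sub_norm_le (1 : ℂ) (r * z)
        rw [norm_one] at this; linarith
      -- This makes the majorant uniform in `r`: the logarithm at `r * z` is bounded below by the
      -- one at `z`, up to `log 2`.
      have h3 : ‖1 - z‖ ≤ 2 * ‖1 - r * z‖ := by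
        have e : 1 - z = (1 - r * z) - ((1 - r : ℝ) : ℂ) * z := by push_cast; ring
        have h4 : ‖((1 - r : ℝ) : ℂ) * z‖ ≤ 1 - r := by
          rw [norm_mul, Complex.norm_real, Real.norm_of_nonneg (by linarith [hr.2])]
          exact mul_le_of_le_one_right (by linarith [hr.2]) hz1
        rw [e]
        refine (norm_sub_le _ _).trans ?_
        linarith
      have hpos' : 0 < ‖1 - r * z‖ := by linarith [hr.2]
      have h5 := Real.log_le_log hpos' h1
      have h6 := Real.log_le_log hpos h3
      rw [Real.log_mul (by norm_num) hpos'.ne'] at h6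
      rw [abs_le]
      constructor
      · linarith [neg_abs_le (Real.log ‖1 - z‖)]
      · linarith [abs_nonneg (Real.log ‖1 - z‖)]
    · filter_upwards [ae_eval_circleMap_ne_zero hp0] with θ hθ hmem
      have hne := hθ hmem
      rw [hpe] at hne
      have hc : ContinuousAt (fun r : ℝ =>
          ((Real.log ‖1 - r * b * circleMap 0 1 θ‖ : ℝ) : ℂ) * circleMap 0 1 θ ^ k) 1 := by
        refine ContinuousAt.mul ?_ continuousAt_const
        refine Complex.continuous_ofReal.continuousAt.comp ?_
        refine ContinuousAt.log (by fun_prop) ?_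
        simpa using hne
      have := hc.tendsto
      simp only [Complex.ofReal_one, one_mul] at this
      exact this.mono_left nhdsWithin_le_nhds
  have hlim' : Tendsto (fun r : ℝ => -(Real.pi / k) * (starRingEnd ℂ) (r * b) ^ k) (𝓝[<] 1)
      (𝓝 (-(Real.pi / k) * (starRingEnd ℂ) b ^ k)) := by
    have hc : Continuous (fun r : ℝ => -(Real.pi / k : ℂ) * (starRingEnd ℂ) (r * b) ^ k) := by
      have := Complex.continuous_conj
      fun_prop
    have := hc.tendsto 1
    simp only [Complex.ofReal_one, one_mul] at this
    exact this.mono_left nhdsWithin_le_nhds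
  refine tendsto_nhds_unique hlim (hlim'.congr' ?_)
  filter_upwards [Ioo_mem_nhdsLT (show (0 : ℝ) < 1 by norm_num)] with r hr
  refine (integral_log_norm_one_sub_mul_pow_of_lt ?_ hk).symm
  rw [norm_mul, Complex.norm_real, Real.norm_of_nonneg hr.1.le]
  exact (mul_le_of_le_one_right hr.1.le hb).trans_lt hr.2

/-- The retraction of the plane onto the closed unit disc that is the inversion in the unit circle
outside the disc. -/
noncomputable def foldToDisc (z : ℂ) : ℂ := z / ((max 1 ‖z‖ : ℝ) : ℂ) ^ 2

lemma continuous_foldToDisc : Continuous foldToDisc := by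
  unfold foldToDisc
  refine Continuous.div continuous_id (by fun_prop) fun z => ?_
  have : 0 < max 1 ‖z‖ := lt_max_of_lt_left one_pos
  exact_mod_cast (pow_pos this 2).ne'

lemma foldToDisc_of_norm_le {z : ℂ} (hz : ‖z‖ ≤ 1) : foldToDisc z = z := by
  simp [foldToDisc, max_eq_left hz]

lemma foldToDisc_of_one_le {z : ℂ} (hz : 1 ≤ ‖z‖) : foldToDisc z = (starRingEnd ℂ) z⁻¹ := by
  have hz0 : z ≠ 0 := norm_pos_iff.1 (one_pos.trans_le hz)
  rw [foldToDisc, max_eq_right hz, ← Complex.mul_conj', map_inv₀]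
  have : (starRingEnd ℂ) z ≠ 0 := by simpa using hz0
  field_simp

lemma norm_foldToDisc_le (z : ℂ) : ‖foldToDisc z‖ ≤ 1 := by
  rcases le_total ‖z‖ 1 with h | h
  · rwa [foldToDisc_of_norm_le h]
  · rw [foldToDisc_of_one_le h, RCLike.norm_conj, norm_inv]
    exact inv_le_one_of_one_le₀ h

/-- The (unnormalised) Fourier coefficient of `log |p|` on the unit circle. -/
noncomputable def logFourier (k : ℕ) (p : ℂ[X]) : ℂ :=
  ∫ θ : ℝ in (0)..(2 * Real.pi),
    ((Real.log ‖p.eval (circleMap 0 1 θ)‖ : ℝ) : ℂ) * circleMap 0 1 θ ^ k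

lemma intervalIntegrable_logFourier (k : ℕ) (p : ℂ[X]) :
    IntervalIntegrable (fun θ : ℝ =>
      ((Real.log ‖p.eval (circleMap 0 1 θ)‖ : ℝ) : ℂ) * circleMap 0 1 θ ^ k) volume 0
        (2 * Real.pi) := by
  have h : IntervalIntegrable (fun θ : ℝ => ((Real.log ‖p.eval (circleMap 0 1 θ)‖ : ℝ) : ℂ))
      volume 0 (2 * Real.pi) :=
    ⟨(intervalIntegrable_mahlerMeasure p).1.ofReal, (intervalIntegrable_mahlerMeasure p).2.ofReal⟩
  exact h.mul_continuousOn (by fun_prop)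

lemma logFourier_C {k : ℕ} (hk : k ≠ 0) (c : ℂ) : logFourier k (C c) = 0 := by
  have h := integral_exp_int_mul_I k
  rw [if_neg (by exact_mod_cast hk)] at h
  have : ∀ θ : ℝ, circleMap 0 1 θ ^ k = Complex.exp ((k : ℤ) * θ * Complex.I) := fun θ => by
    rw [circleMap_zero_one, ← Complex.exp_nat_mul]
    congr 1; push_cast; ring
  simp_rw [logFourier, eval_C]
  rw [intervalIntegral.integral_const_mul]
  simp_rw [this, h, mul_zero]

lemma logFourier_mul (k : ℕ) {p q : ℂ[X]} (hpq : p * q ≠ 0) :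
    logFourier k (p * q) = logFourier k p + logFourier k q := by
  rw [logFourier, logFourier, logFourier, ← intervalIntegral.integral_add
    (intervalIntegrable_logFourier k p) (intervalIntegrable_logFourier k q)]
  refine intervalIntegral.integral_congr_ae ?_
  filter_upwards [ae_eval_circleMap_ne_zero hpq] with θ hθ hmem
  have hne := hθ hmem
  rw [eval_mul] at hne
  rw [eval_mul, norm_mul, Real.log_mul (norm_ne_zero_iff.2 (left_ne_zero_of_mul hne))
    (norm_ne_zero_iff.2 (right_ne_zero_of_mul hne))]
  push_cast
  ring

/-- On the circle `|w - z| = |1 - conj z * w|`, which settles `‖z‖ ≤ 1`. Otherwise the constant `-z`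
factors out and leaves `1 - z⁻¹ * w`, so `conj z⁻¹` takes the place of `z`; this dictates
`foldToDisc`. -/
lemma logFourier_X_sub_C {k : ℕ} (hk : k ≠ 0) (z : ℂ) :
    logFourier k (X - C z) = -(Real.pi / k) * foldToDisc z ^ k := by
  rcases le_or_gt ‖z‖ 1 with hz | hz
  · have hz' : ‖(starRingEnd ℂ) z‖ ≤ 1 := by rwa [RCLike.norm_conj]
    have h := integral_log_norm_one_sub_mul_pow hz' hk
    rw [Complex.conj_conj] at h
    rw [foldToDisc_of_norm_le hz, ← h, logFourier]
    congr 1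
    ext θ
    congr 3
    set w := circleMap 0 1 θ with hw
    have hw1 : ‖w‖ = 1 := by simp [hw]
    have e : 1 - (starRingEnd ℂ) z * w = w * (starRingEnd ℂ) (w - z) := by
      rw [map_sub, mul_sub, Complex.mul_conj', hw1]
      push_cast; ring
    rw [e, norm_mul, hw1, RCLike.norm_conj, one_mul]
    simp
  · have hz0 : z ≠ 0 := norm_pos_iff.1 (one_pos.trans hz)
    have hz' : ‖z⁻¹‖ ≤ 1 := by rw [norm_inv]; exact inv_le_one_of_one_le₀ hz.le
    have h := integral_log_norm_one_sub_mul_pow hz' hk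
    have e : X - C z = C (-z) * (1 - C z⁻¹ * X) := by
      rw [mul_sub, ← mul_assoc, ← C_mul, neg_mul, mul_inv_cancel₀ hz0]
      simp
      ring
    have hne : X - C z ≠ 0 := X_sub_C_ne_zero z
    rw [e] at hne ⊢
    rw [logFourier_mul k hne, logFourier_C hk, zero_add, foldToDisc_of_one_le hz.le, ← h,
      logFourier]
    simp

lemma logFourier_eq_sum_roots {k : ℕ} (hk : k ≠ 0) {p : ℂ[X]} (hp : p ≠ 0) :
    logFourier k p = -(Real.pi / k) * (p.roots.map fun z => foldToDisc z ^ k).sum := by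
  have key : ∀ s : Multiset ℂ, logFourier k (s.map fun z => X - C z).prod =
      -(Real.pi / k) * (s.map fun z => foldToDisc z ^ k).sum := by
    intro s
    induction s using Multiset.induction_on with
    | empty =>
      have := logFourier_C hk 1
      simpa using this
    | cons z s ih =>
      rw [Multiset.map_cons, Multiset.prod_cons, logFourier_mul, ih, logFourier_X_sub_C hk,
        Multiset.map_cons, Multiset.sum_cons, mul_add]
      exact mul_ne_zero (X_sub_C_ne_zero z)
        (monic_multiset_prod_of_monic _ _ fun z _ => monic_X_sub_C z).ne_zero
  have hroots := (IsAlgClosed.splits p).eq_prod_roots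
  rw [hroots] at hp
  conv_lhs => rw [hroots]
  rw [logFourier_mul k hp, logFourier_C hk, zero_add, key]

namespace BalancedPoly

variable {P : ℂ[X]} {n k : ℕ} {L : ℝ}

lemma log_norm_eval_le (h : BalancedPoly P n k L) {w : ℂ} (hw : ‖w‖ = 1) :
    Real.log ‖P.eval w‖ ≤ Real.log (n + 1) := by
  have hn : (0 : ℝ) ≤ n := Nat.cast_nonneg n
  rcases eq_or_ne (P.eval w) 0 with h0 | h0
  · rw [h0, norm_zero, Real.log_zero]
    exact Real.log_nonneg (by linarith)
  · refine Real.log_le_log (norm_pos_iff.2 h0) ?_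
    rw [eval_eq_sum_range, h.natDegree_eq]
    calc _ ≤ ∑ i ∈ Finset.range (n + 1), ‖P.coeff i * w ^ i‖ := norm_sum_le _ _
      _ ≤ ∑ i ∈ Finset.range (n + 1), 1 := by
          refine Finset.sum_le_sum fun i _ => ?_
          rw [norm_mul, norm_pow, hw, one_pow, mul_one]
          exact h.norm_coeff_le i
      _ = n + 1 := by simp

/-- A function `u ≤ B` with `B ≥ 0` satisfies `|u| ≤ 2 * B - u`, so an upper bound and a lower bound
on the mean control the `L¹` norm. The mean of `log |P|` is its logarithmic Mahler measure. -/
lemma norm_logFourier_le (h : BalancedPoly P n k L) (m : ℕ) :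
    ‖logFourier m P‖ ≤ 2 * Real.pi * (2 * Real.log (n + 1) + L) := by
  have hpi : (0 : ℝ) ≤ 2 * Real.pi := by positivity
  have hu := intervalIntegrable_mahlerMeasure P
  have hB : 0 ≤ Real.log ((n : ℝ) + 1) :=
    Real.log_nonneg (by linarith [(Nat.cast_nonneg n : (0 : ℝ) ≤ n)])
  have hM := h.logMahlerMeasure_ge
  rw [logMahlerMeasure_def, Real.circleAverage_def, smul_eq_mul] at hM
  calc ‖logFourier m P‖
      ≤ ∫ θ in (0)..(2 * Real.pi),
          (2 * Real.log (n + 1) - Real.log ‖P.eval (circleMap 0 1 θ)‖) := by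
        refine intervalIntegral.norm_integral_le_of_norm_le hpi
          (Eventually.of_forall fun θ _ => ?_) (intervalIntegrable_const.sub hu)
        have hw : ‖circleMap 0 1 θ‖ = 1 := by simp
        have := h.log_norm_eval_le hw
        rw [norm_mul, norm_pow, hw, one_pow, mul_one, Complex.norm_real, Real.norm_eq_abs, abs_le]
        constructor <;> linarith
    _ = 2 * Real.pi * (2 * Real.log (n + 1)) -
          ∫ θ in (0)..(2 * Real.pi), Real.log ‖P.eval (circleMap 0 1 θ)‖ := by
        rw [intervalIntegral.integral_sub intervalIntegrable_const hu]
        simp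
        ring
    _ ≤ 2 * Real.pi * (2 * Real.log (n + 1)) - 2 * Real.pi * (-L) := by
        gcongr
        calc _ ≤ 2 * Real.pi * ((2 * Real.pi)⁻¹ * ∫ θ in (0)..(2 * Real.pi),
              Real.log ‖P.eval (circleMap 0 1 θ)‖) := by gcongr
          _ = _ := by rw [mul_inv_cancel_left₀ (by positivity)]
    _ = _ := by ring

lemma norm_sum_foldToDisc_pow_le (h : BalancedPoly P n k L) {m : ℕ} (hm : m ≠ 0) :
    ‖(P.roots.map fun z => foldToDisc z ^ m).sum‖ ≤ 2 * m * (2 * Real.log (n + 1) + L) := by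
  have hP : P ≠ 0 := fun h0 => h.leadingCoeff_ne (by simp [h0])
  have hm' : (0 : ℝ) < m := by exact_mod_cast Nat.pos_of_ne_zero hm
  have h1 := h.norm_logFourier_le m
  rw [logFourier_eq_sum_roots hm hP, norm_mul, norm_neg, norm_div, Complex.norm_real,
    Complex.norm_natCast, Real.norm_of_nonneg Real.pi_pos.le] at h1
  have hpm : 0 < Real.pi / m := by positivity
  refine le_of_mul_le_mul_left (h1.trans_eq ?_) hpm
  field_simp

end BalancedPoly

/-! ### From vanishing moments to weak convergence. -/

lemma continuous_exp_two_pi_mul_I :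
    Continuous fun t : ℝ => Complex.exp (2 * Real.pi * t * Complex.I) := by fun_prop

instance isProbabilityMeasure_uniformCircle : IsProbabilityMeasure uniformCircle := by
  have : IsProbabilityMeasure ((volume : Measure ℝ).restrict (Set.Ioo 0 1)) := ⟨by simp⟩
  exact Measure.isProbabilityMeasure_map continuous_exp_two_pi_mul_I.aemeasurable

lemma norm_exp_two_pi_mul_I (t : ℝ) : ‖Complex.exp (2 * Real.pi * t * Complex.I)‖ = 1 := by
  have : (2 * Real.pi * t * Complex.I : ℂ) = ((2 * Real.pi * t : ℝ) : ℂ) * Complex.I := by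
    push_cast; ring
  rw [this, Complex.norm_exp_ofReal_mul_I]

lemma integral_uniformCircle (g : BoundedContinuousFunction ℂ ℂ) :
    ∫ z, g z ∂uniformCircle =
      ∫ t : ℝ in Set.Ioo 0 1, g (Complex.exp (2 * Real.pi * t * Complex.I)) := by
  rw [uniformCircle, integral_map continuous_exp_two_pi_mul_I.aemeasurable
    g.continuous.aestronglyMeasurable]

lemma ae_uniformCircle_norm_eq_one : ∀ᵐ z ∂uniformCircle, ‖z‖ = 1 := by
  rw [uniformCircle, ae_map_iff continuous_exp_two_pi_mul_I.aemeasurable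
    (measurableSet_eq_fun measurable_norm measurable_const)]
  exact Eventually.of_forall norm_exp_two_pi_mul_I

lemma integral_Ioo_exp_two_pi_mul_I_pow {m : ℕ} (hm : m ≠ 0) :
    ∫ t : ℝ in Set.Ioo 0 1, Complex.exp (2 * Real.pi * t * Complex.I) ^ m = 0 := by
  have hc : (m * (2 * Real.pi * Complex.I) : ℂ) ≠ 0 := by
    have := Complex.two_pi_I_ne_zero
    simp [hm]
  have e : ∀ t : ℝ, Complex.exp (2 * Real.pi * t * Complex.I) ^ m =
      Complex.exp (m * (2 * Real.pi * Complex.I) * t) := fun t => by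
    rw [← Complex.exp_nat_mul]; congr 1; ring
  simp_rw [e]
  rw [← integral_Ioc_eq_integral_Ioo, ← intervalIntegral.integral_of_le zero_le_one,
    integral_exp_mul_complex hc]
  simp [Complex.exp_nat_mul_two_pi_mul_I]

/-- The bounded continuous function `z ↦ (foldToDisc z) ^ m`. -/
noncomputable def foldPow (m : ℕ) : BoundedContinuousFunction ℂ ℂ :=
  BoundedContinuousFunction.ofNormedAddCommGroup (fun z => foldToDisc z ^ m)
    (continuous_foldToDisc.pow m) 1 fun z => by
      rw [norm_pow]; exact pow_le_one₀ (norm_nonneg _) (norm_foldToDisc_le z)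

/-- The bounded continuous function `z ↦ conj (foldToDisc z) ^ m`. -/
noncomputable def foldPowConj (m : ℕ) : BoundedContinuousFunction ℂ ℂ :=
  BoundedContinuousFunction.ofNormedAddCommGroup (fun z => (starRingEnd ℂ) (foldToDisc z ^ m))
    (Complex.continuous_conj.comp (continuous_foldToDisc.pow m)) 1 fun z => by
      rw [RCLike.norm_conj, norm_pow]; exact pow_le_one₀ (norm_nonneg _) (norm_foldToDisc_le z)

lemma foldPow_apply (m : ℕ) (z : ℂ) : foldPow m z = foldToDisc z ^ m := rfl

lemma foldPowConj_apply (m : ℕ) (z : ℂ) :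
    foldPowConj m z = (starRingEnd ℂ) (foldToDisc z ^ m) := rfl

lemma integral_foldPow_uniformCircle {m : ℕ} (hm : m ≠ 0) :
    ∫ z, foldPow m z ∂uniformCircle = 0 := by
  rw [integral_uniformCircle, ← integral_Ioo_exp_two_pi_mul_I_pow hm]
  simp_rw [foldPow_apply, foldToDisc_of_norm_le (norm_exp_two_pi_mul_I _).le]

/-- Trigonometric polynomials extend from the circle to bounded continuous functions on the plane
through powers of `foldToDisc` and their conjugates, whose integrals the moment hypothesis controls.
-/
lemma exists_extension_of_mem_span_fourier {μ : ℕ → Measure ℂ}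
    [∀ n, IsProbabilityMeasure (μ n)]
    (hmom : ∀ m : ℕ, m ≠ 0 → Tendsto (fun n => ∫ z, foldToDisc z ^ m ∂μ n) atTop (𝓝 0))
    {p : C(AddCircle (1 : ℝ), ℂ)} (hp : p ∈ Submodule.span ℂ (Set.range (@fourier 1))) :
    ∃ g : BoundedContinuousFunction ℂ ℂ,
      (∀ t : ℝ, g (Complex.exp (2 * Real.pi * t * Complex.I)) = p (t : AddCircle (1 : ℝ))) ∧
      Tendsto (fun n => ∫ z, g z ∂μ n) atTop (𝓝 (∫ z, g z ∂uniformCircle)) := by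
  induction hp using Submodule.span_induction with
  | mem p hp =>
    obtain ⟨m, rfl⟩ := hp
    have hpow : ∀ m : ℕ, (∀ t : ℝ, foldPow m (Complex.exp (2 * Real.pi * t * Complex.I)) =
        Complex.exp (2 * Real.pi * Complex.I * m * t / 1)) ∧
        Tendsto (fun n => ∫ z, foldPow m z ∂μ n) atTop (𝓝 (∫ z, foldPow m z ∂uniformCircle)) := by
      intro m
      refine ⟨fun t => ?_, ?_⟩
      · rw [foldPow_apply, foldToDisc_of_norm_le (norm_exp_two_pi_mul_I _).le,
          ← Complex.exp_nat_mul]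
        congr 1; ring
      · rcases eq_or_ne m 0 with rfl | hm
        · simp [foldPow_apply]
        · rw [integral_foldPow_uniformCircle hm]
          exact hmom m hm
    rcases le_total 0 m with hm | hm
    · lift m to ℕ using hm
      refine ⟨foldPow m, fun t => ?_, (hpow m).2⟩
      rw [(hpow m).1, fourier_coe_apply]
      simp
    · obtain ⟨j, rfl⟩ : ∃ j : ℕ, m = -(j : ℤ) := ⟨m.natAbs, by omega⟩
      refine ⟨foldPowConj j, fun t => ?_, ?_⟩
      · rw [foldPowConj_apply, ← foldPow_apply, (hpow j).1, fourier_coe_apply, ← Complex.exp_conj]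
        congr 1
        simp [map_ofNat (starRingEnd ℂ) 2]
      · simp_rw [foldPowConj_apply, ← foldPow_apply, integral_conj]
        exact (Complex.continuous_conj.tendsto _).comp (hpow j).2
  | zero => exact ⟨0, by simp, by simp⟩
  | add p q _ _ hp hq =>
    obtain ⟨g, hg, hg'⟩ := hp
    obtain ⟨h, hh, hh'⟩ := hq
    refine ⟨g + h, fun t => by simp [hg, hh], ?_⟩
    simp only [BoundedContinuousFunction.coe_add, Pi.add_apply]
    rw [integral_add (g.integrable _) (h.integrable _)]
    simp_rw [integral_add (g.integrable (μ _)) (h.integrable (μ _))]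
    exact hg'.add hh'
  | smul c p _ hp =>
    obtain ⟨g, hg, hg'⟩ := hp
    refine ⟨c • g, fun t => by simp [hg], ?_⟩
    simp only [BoundedContinuousFunction.coe_smul, integral_smul]
    exact hg'.const_smul c

lemma exists_exp_two_pi_mul_I_eq {z : ℂ} (hz : ‖z‖ = 1) :
    ∃ t : ℝ, Complex.exp (2 * Real.pi * t * Complex.I) = z := by
  refine ⟨z.arg / (2 * Real.pi), ?_⟩
  have h := Complex.norm_mul_exp_arg_mul_I z
  rw [hz, Complex.ofReal_one, one_mul] at h
  conv_rhs => rw [← h]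
  congr 1
  have : (Real.pi : ℂ) ≠ 0 := by exact_mod_cast Real.pi_ne_zero
  push_cast
  field_simp

lemma exists_fourier_approx (f : BoundedContinuousFunction ℂ ℂ) {ε : ℝ} (hε : 0 < ε) :
    ∃ p ∈ Submodule.span ℂ (Set.range (@fourier 1)),
      ∀ t : ℝ, ‖f (Complex.exp (2 * Real.pi * t * Complex.I)) - p (t : AddCircle (1 : ℝ))‖ < ε := by
  have : Fact ((0 : ℝ) < 1) := ⟨one_pos⟩
  set g : C(AddCircle (1 : ℝ), ℂ) :=
    ⟨fun x => f (AddCircle.toCircle x : ℂ), by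
      have := AddCircle.continuous_toCircle (T := 1)
      fun_prop⟩ with hg
  have hmem : g ∈ (Submodule.span ℂ (Set.range (@fourier 1))).topologicalClosure := by
    rw [span_fourier_closure_eq_top]; trivial
  rw [← SetLike.mem_coe, Submodule.topologicalClosure_coe, Metric.mem_closure_iff] at hmem
  obtain ⟨p, hp, hd⟩ := hmem ε hε
  refine ⟨p, hp, fun t => ?_⟩
  have h1 := (ContinuousMap.dist_apply_le_dist (f := g) (g := p)
    (t : AddCircle (1 : ℝ))).trans_lt hd
  rw [dist_eq_norm] at h1
  have e : g (t : AddCircle (1 : ℝ)) = f (Complex.exp (2 * Real.pi * t * Complex.I)) := by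
    simp only [hg, ContinuousMap.coe_mk, AddCircle.toCircle_apply_mk, Circle.coe_exp]
    congr 2
    push_cast
    ring
  rwa [e] at h1

/-- Choose `g` extending a trigonometric polynomial close to `f` on the circle. By compactness `f -
g` stays small on an annulus, and outside it the mass tends to zero while `f - g` is bounded. -/
lemma tendsto_integral_uniformCircle {μ : ℕ → Measure ℂ} [∀ n, IsProbabilityMeasure (μ n)]
    (hrad : ∀ δ > 0, Tendsto (fun n => (μ n).real {z : ℂ | δ ≤ |‖z‖ - 1|}) atTop (𝓝 0))
    (hmom : ∀ m : ℕ, m ≠ 0 → Tendsto (fun n => ∫ z, foldToDisc z ^ m ∂μ n) atTop (𝓝 0))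
    (f : BoundedContinuousFunction ℂ ℂ) :
    Tendsto (fun n => ∫ z, f z ∂μ n) atTop (𝓝 (∫ z, f z ∂uniformCircle)) := by
  rw [Metric.tendsto_atTop']
  suffices h : ∀ ε > 0, ∀ᶠ n in atTop,
      dist (∫ z, f z ∂μ n) (∫ z, f z ∂uniformCircle) < 4 * ε by
    intro ε hε
    obtain ⟨N, hN⟩ := eventually_atTop.1 (h (ε / 4) (by positivity))
    refine ⟨N, fun n hn => ?_⟩
    have := hN n hn.le
    linarith
  intro ε hε
  obtain ⟨p, hp, hfp⟩ := exists_fourier_approx f hε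
  obtain ⟨g, hgp, hg⟩ := exists_extension_of_mem_span_fourier hmom hp
  have hcirc : ∀ z : ℂ, ‖z‖ = 1 → ‖(f - g) z‖ < ε := by
    intro z hz
    obtain ⟨t, rfl⟩ := exists_exp_two_pi_mul_I_eq hz
    rw [BoundedContinuousFunction.coe_sub, Pi.sub_apply, hgp]
    exact hfp t
  obtain ⟨δ, hδ, hsub⟩ := (isCompact_sphere (0 : ℂ) 1).exists_thickening_subset_open
    (isOpen_lt (by fun_prop : Continuous fun z => ‖(f - g) z‖) continuous_const)
    (fun z hz => hcirc z (by simpa using hz))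
  have hnear : ∀ z : ℂ, |‖z‖ - 1| < min δ 1 → ‖(f - g) z‖ < ε := by
    intro z hz
    refine hsub ?_
    have hz0 : 0 < ‖z‖ := by
      have := (abs_lt.1 (hz.trans_le (min_le_right _ _))).1
      linarith
    have hzne : (‖z‖ : ℂ) ≠ 0 := by exact_mod_cast hz0.ne'
    rw [Metric.mem_thickening_iff]
    -- The radial projection lies at distance `|‖z‖ - 1|`; the cap `min δ 1` keeps `z` away from
    -- `0`.
    refine ⟨z / ‖z‖, by simp [hz0.ne'], ?_⟩
    rw [dist_eq_norm]
    have e : z - z / ‖z‖ = (((‖z‖ - 1) / ‖z‖ : ℝ) : ℂ) * z := by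
      push_cast; field_simp
    rw [e, norm_mul, Complex.norm_real, norm_div, Real.norm_eq_abs, norm_norm,
      div_mul_cancel₀ _ hz0.ne']
    exact hz.trans_le (min_le_left _ _)
  set S : Set ℂ := {z : ℂ | min δ 1 ≤ |‖z‖ - 1|} with hS
  have hSm : MeasurableSet S := measurableSet_le measurable_const (by fun_prop)
  have hout := hrad (min δ 1) (lt_min hδ one_pos)
  have hB : Tendsto (fun n => ‖f - g‖ * (μ n).real S) atTop (𝓝 0) := by
    have := hout.const_mul ‖f - g‖
    rwa [mul_zero] at this
  have hcircint : ‖∫ z, f z ∂uniformCircle - ∫ z, g z ∂uniformCircle‖ ≤ ε := by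
    rw [← integral_sub (f.integrable _) (g.integrable _)]
    refine (norm_integral_le_of_norm_le_const (C := ε) ?_).trans_eq (by simp)
    filter_upwards [ae_uniformCircle_norm_eq_one] with z hz
    exact (hcirc z hz).le
  have hint : ∀ n, ‖∫ z, f z ∂μ n - ∫ z, g z ∂μ n‖ ≤ ε + ‖f - g‖ * (μ n).real S := by
    intro n
    rw [← integral_sub (f.integrable _) (g.integrable _)]
    calc ‖∫ z, (f z - g z) ∂μ n‖
        ≤ ∫ z, (ε + S.indicator (fun _ => ‖f - g‖) z) ∂μ n := by
          refine norm_integral_le_of_norm_le ?_ (Eventually.of_forall fun z => ?_)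
          · exact (integrable_const _).add ((integrable_const _).indicator hSm)
          · by_cases hz : z ∈ S
            · rw [Set.indicator_of_mem hz]
              have := (f - g).norm_coe_le_norm z
              rw [BoundedContinuousFunction.coe_sub, Pi.sub_apply] at this
              linarith
            · rw [Set.indicator_of_notMem hz, add_zero]
              rw [hS, Set.mem_ofPred_eq, not_le] at hz
              exact (hnear z hz).le
      _ = ε + ‖f - g‖ * (μ n).real S := by
          rw [integral_add (integrable_const _) ((integrable_const _).indicator hSm),
            integral_indicator hSm]
          simp [mul_comm]
  filter_upwards [(Metric.tendsto_nhds.1 hg) ε hε, hB.eventually (gt_mem_nhds hε)] with n h1 h2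
  rw [dist_eq_norm] at h1 ⊢
  have e : ∫ z, f z ∂μ n - ∫ z, f z ∂uniformCircle =
      (∫ z, f z ∂μ n - ∫ z, g z ∂μ n) + (∫ z, g z ∂μ n - ∫ z, g z ∂uniformCircle) -
        (∫ z, f z ∂uniformCircle - ∫ z, g z ∂uniformCircle) := by ring
  rw [e]
  refine (norm_sub_le _ _).trans_lt ?_
  have := norm_add_le (∫ z, f z ∂μ n - ∫ z, g z ∂μ n)
    (∫ z, g z ∂μ n - ∫ z, g z ∂uniformCircle)
  linarith [hint n]

/-- Probability measures on the plane that concentrate near the unit circle and whose folded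
moments vanish asymptotically converge to the uniform law on the unit circle. -/
theorem tendsto_levyProkhorovDist_uniformCircle {μ : ℕ → Measure ℂ}
    [hprob : ∀ n, IsProbabilityMeasure (μ n)]
    (hrad : ∀ δ > 0, Tendsto (fun n => (μ n).real {z : ℂ | δ ≤ |‖z‖ - 1|}) atTop (𝓝 0))
    (hmom : ∀ m : ℕ, m ≠ 0 → Tendsto (fun n => ∫ z, foldToDisc z ^ m ∂μ n) atTop (𝓝 0)) :
    Tendsto (fun n => levyProkhorovDist (μ n) uniformCircle) atTop (𝓝 0) := by
  set ν : ℕ → ProbabilityMeasure ℂ := fun n => ⟨μ n, hprob n⟩ with hν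
  set ν₀ : ProbabilityMeasure ℂ := ⟨uniformCircle, inferInstance⟩ with hν₀
  have hweak : Tendsto ν atTop (𝓝 ν₀) := by
    rw [ProbabilityMeasure.tendsto_iff_forall_integral_tendsto]
    intro f
    -- Real test functions are complexified, and real parts are taken afterwards.
    have h := tendsto_integral_uniformCircle hrad hmom
      (BoundedContinuousFunction.ofNormedAddCommGroup (fun z => (f z : ℂ)) (by fun_prop) ‖f‖
        fun z => by rw [Complex.norm_real]; exact f.norm_coe_le_norm z)
    simp only [BoundedContinuousFunction.coe_ofNormedAddCommGroup, integral_complex_ofReal] at h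
    simpa [Function.comp_def, hν, hν₀] using (Complex.continuous_re.tendsto _).comp h
  have h := (LevyProkhorov.continuous_ofMeasure_probabilityMeasure.tendsto ν₀).comp hweak
  rw [tendsto_iff_dist_tendsto_zero] at h
  exact h

/-! ### Application to the log-concave polynomials. -/

lemma coeff_coeffPoly {n : ℕ} (a : Fin (n + 1) → ℝ) (i : ℕ) :
    (coeffPoly a).coeff i = if h : i < n + 1 then (a ⟨i, h⟩ : ℂ) else 0 := by
  simp only [coeffPoly, finsetSum_coeff, coeff_C_mul_X_pow]
  split_ifs with h
  · rw [Finset.sum_eq_single (⟨i, h⟩ : Fin (n + 1))]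
    · simp
    · intro j _ hj
      rw [if_neg]
      rintro rfl
      exact hj rfl
    · simp
  · refine Finset.sum_eq_zero fun j _ => if_neg ?_
    have := j.2
    omega

/-- The size of the logarithms of the relevant coefficients in degree `n`. -/
noncomputable def logScale (n : ℕ) : ℝ := (Nat.sqrt n + 1) * Real.log (16 * (n + 1))

lemma one_le_log_sixteen_mul (n : ℕ) : 1 ≤ Real.log (16 * ((n : ℝ) + 1)) := by
  have hn : (0 : ℝ) ≤ n := Nat.cast_nonneg n
  rw [Real.le_log_iff_exp_le (by positivity)]
  linarith [Real.exp_one_lt_d9]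

lemma natSqrt_le_logScale (n : ℕ) : (Nat.sqrt n : ℝ) ≤ logScale n := by
  have := one_le_log_sixteen_mul n
  unfold logScale
  nlinarith [(Nat.cast_nonneg (Nat.sqrt n) : (0 : ℝ) ≤ Nat.sqrt n)]

lemma log_succ_le_logScale (n : ℕ) : Real.log (n + 1) ≤ logScale n := by
  have hn : (0 : ℝ) ≤ n := Nat.cast_nonneg n
  have h1 := one_le_log_sixteen_mul n
  have h2 : Real.log (n + 1) ≤ Real.log (16 * (n + 1)) :=
    Real.log_le_log (by positivity) (by linarith)
  unfold logScale
  nlinarith [(Nat.cast_nonneg (Nat.sqrt n) : (0 : ℝ) ≤ Nat.sqrt n)]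

lemma logScale_nonneg (n : ℕ) : 0 ≤ logScale n :=
  (Nat.cast_nonneg _).trans (natSqrt_le_logScale n)

lemma tendsto_logScale_div : Tendsto (fun n : ℕ => logScale n / n) atTop (𝓝 0) := by
  have h1 : Tendsto (fun x : ℝ => Real.log x / x ^ (1 / 2 : ℝ)) atTop (𝓝 0) :=
    (isLittleO_log_rpow_atTop (by norm_num)).tendsto_div_nhds_zero
  have h2 : Tendsto (fun n : ℕ => 16 * ((n : ℝ) + 1)) atTop atTop :=
    (tendsto_natCast_atTop_atTop.atTop_add tendsto_const_nhds).const_mul_atTop (by norm_num)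
  have h3 := (h1.comp h2).const_mul 64
  rw [mul_zero] at h3
  refine squeeze_zero' (Eventually.of_forall fun n =>
    div_nonneg (logScale_nonneg n) (Nat.cast_nonneg n)) ?_ h3
  filter_upwards [eventually_ge_atTop 1] with n hn
  have hn1 : (1 : ℝ) ≤ n := by exact_mod_cast hn
  have hlog := one_le_log_sixteen_mul n
  simp only [Function.comp_apply, ← Real.sqrt_eq_rpow]
  set N : ℝ := 16 * (n + 1) with hN
  have hNpos : 0 < N := by positivity
  have hs : (Nat.sqrt n : ℝ) + 1 ≤ 2 * √N := by
    have e1 : (Nat.sqrt n : ℝ) ≤ √N := Real.nat_sqrt_le_real_sqrt.trans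
      (Real.sqrt_le_sqrt (by linarith))
    have e2 : 1 ≤ √N := Real.one_le_sqrt.2 (by linarith)
    linarith
  have hsq : √N * √N = N := Real.mul_self_sqrt hNpos.le
  have hspos : 0 < √N := Real.sqrt_pos.2 hNpos
  rw [logScale, ← mul_div_assoc, div_le_div_iff₀ (by linarith) hspos]
  calc (Nat.sqrt n + 1) * Real.log N * √N ≤ 2 * √N * Real.log N * √N := by gcongr
    _ = 2 * (√N * √N) * Real.log N := by ring
    _ = 2 * N * Real.log N := by rw [hsq]
    _ ≤ 2 * (32 * n) * Real.log N := by gcongr; linarith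
    _ = 64 * Real.log N * n := by ring

lemma balancedPoly_coeffPoly {n : ℕ} (hn : 4 ≤ n) {a : Fin (n + 1) → ℝ}
    (ha : a ∈ largeLogConcaveSet n) :
    BalancedPoly (coeffPoly a) n (Nat.sqrt n) (logScale n) := by
  set k := Nat.sqrt n with hk
  have hkn : k * k ≤ n := Nat.sqrt_le n
  have hkn' : n + 1 ≤ (k + 1) ^ 2 := by
    have := Nat.lt_succ_sqrt n
    rw [sq]
    exact this
  -- This places both `k` and `n - k` in the range `[k, n - k]` of the coefficient bound.
  have h2k : k + k ≤ n := by
    rcases Nat.lt_or_ge k 2 with h | h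
    · omega
    · nlinarith
  have hc : ∀ i, 0 < a i ∧ a i < 1 := fun i => ha.1.1 i trivial
  have hnorm : ∀ i (h : i < n + 1), ‖(coeffPoly a).coeff i‖ = a ⟨i, h⟩ := fun i h => by
    rw [coeff_coeffPoly, dif_pos h, Complex.norm_real, Real.norm_of_nonneg (hc _).1.le]
  have hdeg : (coeffPoly a).natDegree = n := by
    refine natDegree_eq_of_le_of_coeff_ne_zero ?_ ?_
    · refine natDegree_le_iff_coeff_eq_zero.2 fun i hi => ?_
      rw [coeff_coeffPoly, dif_neg (by omega)]
    · rw [← norm_ne_zero_iff, hnorm n (by omega)]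
      exact (hc _).1.ne'
  -- `exp (-logScale n)` equals `(16 * (n + 1)) ^ (-(k + 1))`: the `16` accounts for the coefficient
  -- bound, the `n + 1` for the binomial coefficient.
  have hsmall : Real.exp (-logScale n) * n.choose k ≤ (1 / 16) ^ (k + 1) := by
    have hN : (0 : ℝ) < n + 1 := by positivity
    have e : Real.exp (-logScale n) = (1 / 16) ^ (k + 1) * (1 / (n + 1)) ^ (k + 1) := by
      rw [← mul_pow, ← Real.exp_log (show (0 : ℝ) < 1 / 16 * (1 / (n + 1)) by positivity),
        ← Real.exp_nat_mul, logScale]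
      congr 1
      rw [show (1 / 16 * (1 / (n + 1)) : ℝ) = (16 * ((n : ℝ) + 1))⁻¹ by field_simp, Real.log_inv]
      push_cast
      ring
    have hch : (n.choose k : ℝ) ≤ (n + 1) ^ (k + 1) := by
      have h1 : n.choose k ≤ n ^ k := Nat.choose_le_pow n k
      have h2 : n ^ k ≤ (n + 1) ^ (k + 1) :=
        (Nat.pow_le_pow_left (Nat.le_succ n) k).trans
          (Nat.pow_le_pow_right (Nat.succ_pos n) (Nat.le_succ k))
      exact_mod_cast h1.trans h2
    rw [e, mul_assoc]
    refine mul_le_of_le_one_right (by positivity) ?_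
    rw [one_div, inv_pow]
    exact inv_mul_le_one_of_le₀ hch (by positivity)
  refine ⟨hdeg, ?_, by omega, fun i => ?_, ?_, ?_⟩
  · rw [leadingCoeff, hdeg, ← norm_ne_zero_iff, hnorm n (by omega)]
    exact (hc _).1.ne'
  · by_cases hi : i < n + 1
    · rw [hnorm i hi]; exact (hc _).2.le
    · rw [coeff_coeffPoly, dif_neg hi]; simp
  · rw [hnorm k (by omega)]
    exact hsmall.trans (pow_lt_apply_of_mem_largeLogConcaveSet ha hkn' le_rfl h2k).le
  · rw [hnorm (n - k) (by omega)]
    exact hsmall.trans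
      (pow_lt_apply_of_mem_largeLogConcaveSet ha hkn' (by omega) (by omega)).le

lemma integrable_sum_dirac (s : Multiset ℂ) (g : ℂ → ℂ) :
    Integrable g (s.map fun z => Measure.dirac z).sum := by
  induction s using Multiset.induction_on with
  | empty => simp
  | cons z s ih =>
    rw [Multiset.map_cons, Multiset.sum_cons]
    exact (integrable_dirac (by simp)).add_measure ih

lemma integral_sum_dirac (s : Multiset ℂ) (g : ℂ → ℂ) :
    ∫ z, g z ∂(s.map fun z => Measure.dirac z).sum = (s.map g).sum := by
  induction s using Multiset.induction_on with
  | empty => simp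
  | cons z s ih =>
    rw [Multiset.map_cons, Multiset.sum_cons, Multiset.map_cons, Multiset.sum_cons,
      integral_add_measure (integrable_dirac (by simp)) (integrable_sum_dirac s g), ih,
      integral_dirac]

open Classical in
lemma sum_dirac_apply (s : Multiset ℂ) (A : Set ℂ) :
    (s.map fun z => Measure.dirac z).sum A = s.countP fun z => z ∈ A := by
  induction s using Multiset.induction_on with
  | empty => simp
  | cons z s ih =>
    rw [Multiset.map_cons, Multiset.sum_cons, Measure.add_apply, ih, Measure.dirac_apply,
      Multiset.countP_cons, add_comm]
    by_cases hz : z ∈ A <;> simp [hz]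

lemma integral_empiricalRootMeasure {n : ℕ} (a : Fin (n + 1) → ℝ) (g : ℂ → ℂ) :
    ∫ z, g z ∂empiricalRootMeasure a = (n : ℂ)⁻¹ * ((coeffPoly a).roots.map g).sum := by
  rw [empiricalRootMeasure, integral_smul_measure, integral_sum_dirac]
  simp

open Classical in
lemma empiricalRootMeasure_real {n : ℕ} (a : Fin (n + 1) → ℝ) (A : Set ℂ) :
    (empiricalRootMeasure a).real A =
      (n : ℝ)⁻¹ * ((coeffPoly a).roots.countP fun z => z ∈ A) := by
  rw [Measure.real, empiricalRootMeasure, Measure.smul_apply, sum_dirac_apply]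
  simp

namespace BalancedPoly

variable {n k : ℕ} {L : ℝ} {a : Fin (n + 1) → ℝ}

lemma isProbabilityMeasure (h : BalancedPoly (coeffPoly a) n k L) (hn : n ≠ 0) :
    IsProbabilityMeasure (empiricalRootMeasure a) := by
  classical
  refine ⟨?_⟩
  rw [empiricalRootMeasure, Measure.smul_apply, sum_dirac_apply, smul_eq_mul]
  simp only [Set.mem_univ, Multiset.countP_True, h.card_roots]
  exact ENNReal.inv_mul_cancel (by exact_mod_cast hn) (ENNReal.natCast_ne_top n)

lemma norm_moment_le (h : BalancedPoly (coeffPoly a) n k L) {m : ℕ} (hm : m ≠ 0)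
    (hlog : Real.log (n + 1) ≤ L) :
    ‖∫ z, foldToDisc z ^ m ∂empiricalRootMeasure a‖ ≤ 6 * m * (L / n) := by
  have h1 := h.norm_sum_foldToDisc_pow_le hm
  rw [integral_empiricalRootMeasure, norm_mul, norm_inv, Complex.norm_natCast]
  calc _ ≤ (n : ℝ)⁻¹ * (2 * m * (2 * L + L)) := by
        gcongr
        exact h1.trans (by gcongr)
    _ = _ := by ring

lemma real_le (h : BalancedPoly (coeffPoly a) n k L) {δ : ℝ} (hδ : 0 < δ)
    (hlog : Real.log (n + 1) ≤ L) (hk : (k : ℝ) ≤ L) :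
    (empiricalRootMeasure a).real {z : ℂ | δ ≤ |‖z‖ - 1|} ≤
      (8 / Real.log (1 + δ) + 3) * (L / n) := by
  classical
  -- Then `exp (2 * s) = 1 + δ` and `exp (-s) ≥ 1 / (1 + δ) ≥ 1 - δ`, so the two root counts cover
  -- both sides of the annulus.
  set s := Real.log (1 + δ) / 2 with hs
  have hs2 : 2 * s = Real.log (1 + δ) := by rw [hs]; ring
  have hspos : 0 < s := half_pos (Real.log_pos (by linarith))
  have h1 := h.countP_norm_le hspos
  have h2 := h.countP_le_norm hspos
  have hexp : Real.exp (2 * s) = 1 + δ := by rw [hs2, Real.exp_log (by linarith)]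
  have hexp' : 1 - δ ≤ Real.exp (-s) := by
    have e1 : Real.exp (-(2 * s)) ≤ Real.exp (-s) := Real.exp_le_exp.2 (by linarith)
    have e2 : 1 - δ ≤ Real.exp (-(2 * s)) := by
      rw [Real.exp_neg, hexp, ← one_div, le_div_iff₀ (by linarith)]
      nlinarith
    exact e2.trans e1
  have hcount : ((coeffPoly a).roots.countP fun z => z ∈ {z : ℂ | δ ≤ |‖z‖ - 1|}) ≤
      ((coeffPoly a).roots.countP fun z => ‖z‖ ≤ Real.exp (-s)) +
        (coeffPoly a).roots.countP fun z => Real.exp (2 * s) ≤ ‖z‖ := by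
    generalize (coeffPoly a).roots = r
    induction r using Multiset.induction_on with
    | empty => simp
    | cons z r ih =>
      simp only [Multiset.countP_cons]
      have : z ∈ {z : ℂ | δ ≤ |‖z‖ - 1|} → ‖z‖ ≤ Real.exp (-s) ∨ Real.exp (2 * s) ≤ ‖z‖ := by
        intro hz
        rw [Set.mem_ofPred_eq] at hz
        rcases le_abs.1 hz with hz | hz
        · right; linarith
        · left; linarith
      split_ifs <;> first | omega | tauto
  rw [empiricalRootMeasure_real]
  set A := (coeffPoly a).roots.countP fun z => z ∈ {z : ℂ | δ ≤ |‖z‖ - 1|} with hA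
  have hcount' : s * A ≤ 4 * L + 3 * L * s := by
    have hc : (A : ℝ) ≤ ((coeffPoly a).roots.countP fun z => ‖z‖ ≤ Real.exp (-s)) +
        (coeffPoly a).roots.countP fun z => Real.exp (2 * s) ≤ ‖z‖ := by exact_mod_cast hcount
    have hc' := mul_le_mul_of_nonneg_left hc hspos.le
    have hks := mul_le_mul_of_nonneg_right hk hspos.le
    rw [mul_add] at hc'
    linarith
  have hA' : (A : ℝ) ≤ (8 / Real.log (1 + δ) + 3) * L := by
    refine le_of_mul_le_mul_left (hcount'.trans_eq ?_) hspos
    rw [← hs2]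
    field_simp
    ring
  calc (n : ℝ)⁻¹ * A ≤ (n : ℝ)⁻¹ * ((8 / Real.log (1 + δ) + 3) * L) := by gcongr
    _ = _ := by ring

end BalancedPoly

/-- Deterministic form: the root measures of log-concave polynomials whose coefficients have
geometric mean at least `1 / 16` converge to the uniform law on the circle. -/
theorem tendsto_levyProkhorovDist_of_mem_largeLogConcaveSet (a : (n : ℕ) → Fin (n + 1) → ℝ)
    (ha : ∀ᶠ n in atTop, a n ∈ largeLogConcaveSet n) :
    Tendsto (fun n : ℕ => levyProkhorovDist (empiricalRootMeasure (a n)) uniformCircle)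
      atTop (𝓝 0) := by
  classical
  have hgood : ∀ᶠ n in atTop, n ≠ 0 ∧
      BalancedPoly (coeffPoly (a n)) n (Nat.sqrt n) (logScale n) := by
    filter_upwards [ha, eventually_ge_atTop 4] with n hn hn4
    exact ⟨by omega, balancedPoly_coeffPoly hn4 hn⟩
  -- Finitely many empirical measures may fail to have mass one, for instance at `n = 0`; replacing
  -- them does not affect the limit.
  set μ : ℕ → Measure ℂ := fun n =>
    if IsProbabilityMeasure (empiricalRootMeasure (a n)) then empiricalRootMeasure (a n)
    else uniformCircle with hμ
  have hμprob : ∀ n, IsProbabilityMeasure (μ n) := fun n => by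
    simp only [hμ]
    split_ifs with h
    · exact h
    · infer_instance
  have hμeq : ∀ᶠ n in atTop, μ n = empiricalRootMeasure (a n) := by
    filter_upwards [hgood] with n hn
    exact if_pos (hn.2.isProbabilityMeasure hn.1)
  have key : Tendsto (fun n => levyProkhorovDist (μ n) uniformCircle) atTop (𝓝 0) := by
    refine tendsto_levyProkhorovDist_uniformCircle (fun δ hδ => ?_) (fun m hm => ?_)
    · have hlim := tendsto_logScale_div.const_mul (8 / Real.log (1 + δ) + 3)
      rw [mul_zero] at hlim
      refine squeeze_zero' (Eventually.of_forall fun n => measureReal_nonneg) ?_ hlim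
      filter_upwards [hgood, hμeq] with n hn hn'
      rw [hn']
      exact hn.2.real_le hδ (log_succ_le_logScale n) (natSqrt_le_logScale n)
    · have hlim := tendsto_logScale_div.const_mul (6 * m : ℝ)
      rw [mul_zero] at hlim
      refine squeeze_zero_norm' ?_ hlim
      filter_upwards [hgood, hμeq] with n hn hn'
      rw [hn']
      exact hn.2.norm_moment_le hm (log_succ_le_logScale n)
  refine key.congr' ?_
  filter_upwards [hμeq] with n hn
  rw [hn]

theorem theoremA {Ω : Type*} [MeasurableSpace Ω] (P : Measure Ω) [IsProbabilityMeasure P]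
    (a : (n : ℕ) → Ω → Fin (n + 1) → ℝ)
    (ha : ∀ n : ℕ, HasLaw (a n) (uniformModel n) P) :
    ∀ᵐ ω ∂P, Tendsto
      (fun n : ℕ => levyProkhorovDist (empiricalRootMeasure (a n ω)) uniformCircle)
      atTop (𝓝 0) := by
  filter_upwards [ae_eventually_mem_largeLogConcaveSet P a ha] with ω hω
  exact tendsto_levyProkhorovDist_of_mem_largeLogConcaveSet (fun n => a n ω) hω
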